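/- Let $\omega\in\mathbb R$, $\omega\neq 0$. Let $p\in C^1([0,\infty);\mathbb R)$ satisfy $p(t)>0$ and $p'(t)<0$ for all $t\ge 0$, $\int_0^\infty p(t)\,dt=\infty$ and $\int_0^\infty p(t)^2\,dt<\infty$, and let $f\in L^1_{\mathrm{loc}}([0,\infty);\mathbb R)$. Let $x$ be the solution of $$x''(t)+p(t)x'(t)+\omega^2x(t)=f(t),\quad t\ge 0,\qquad x(0)=0,\quad x'(0)=0,$$ that is, $x$ is differentiable on $[0,\infty)$, $x'$ is absolutely continuous on every interval $[0,T]$, and the equation holds for almost every $t>0$. Define, for $t\ge 0$, $$A(t)=\exp\Big(\tfrac12\int_0^t p(\tau)\,d\tau\Big),\qquad y_1(t)=\int_0^t e^{-\omega^2(t-s)}f(s)\,ds,\qquad y_2(t)=\int_0^t e^{-\omega^2(t-s)}y_1(s)\,ds,$$ so that $A(t)\to\infty$ as $t\to\infty$, $y_1'=-\omega^2y_1+f$ (almost everywhere), $y_1(0)=0$, and $y_2'=-\omega^2y_2+y_1$, $y_2(0)=0$. Then $x(t)\to 0$ as $t\to\infty$ if and only if the following three conditions hold together: 1. $y_2(t)\to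 0$ as $t\to\infty$; 2. $\int_0^t\cos(\omega s)A(s)y_2(s)\,ds=o(A(t))$ as $t\to\infty$; 3. $\int_0^t\sin(\omega s)A(s)y_2(s)\,ds=o(A(t))$ as $t\to\infty$. -/

import Mathlib

open Filter Topology MeasureTheory Set Asymptotics

noncomputable section

/-- `x` solves `x'' + p x' + ω² x = f` on `[0, ∞)` with `x(0) = ξ₀` and `x'(0) = ξ₁`.  As the
forcing is only locally integrable, this is the usual (Carathéodory) notion: `x` is differentiable
on `[0, ∞)` (one-sidedly at `0`), its derivative is absolutely continuous on every interval
`[0, T]`, and the equation holds at almost every `t > 0`. -/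
structure IsForcedOscillatorSolution (ω : ℝ) (p f : ℝ → ℝ) (ξ₀ ξ₁ : ℝ) (x : ℝ → ℝ) : Prop where
  differentiableOn : DifferentiableOn ℝ x (Ici 0)
  absolutelyContinuous :
    ∀ T : ℝ, 0 ≤ T → AbsolutelyContinuousOnInterval (derivWithin x (Ici 0)) 0 T
  equation : ∀ᵐ t ∂(volume.restrict (Ioi (0 : ℝ))),
    HasDerivAt (derivWithin x (Ici 0))
      (f t - p t * derivWithin x (Ici 0) t - ω ^ 2 * x t) t
  initial_value : x 0 = ξ₀
  initial_velocity : derivWithin x (Ici 0) 0 = ξ₁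

/-- The first filtered forcing `y₁(t) = ∫₀ᵗ e^{-ω²(t-s)} f(s) ds`, that is, the solution of
`y₁' = -ω² y₁ + f`, `y₁(0) = 0`. -/
def filteredForcing₁ (ω : ℝ) (f : ℝ → ℝ) (t : ℝ) : ℝ :=
  ∫ s in (0 : ℝ)..t, Real.exp (-ω ^ 2 * (t - s)) * f s

/-- The second filtered forcing `y₂(t) = ∫₀ᵗ e^{-ω²(t-s)} y₁(s) ds`, that is, the solution of
`y₂' = -ω² y₂ + y₁`, `y₂(0) = 0`. -/
def filteredForcing₂ (ω : ℝ) (f : ℝ → ℝ) (t : ℝ) : ℝ :=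
  ∫ s in (0 : ℝ)..t, Real.exp (-ω ^ 2 * (t - s)) * filteredForcing₁ ω f s

/-- The weight `A(t) = exp(½ ∫₀ᵗ p(τ) dτ)`. -/
def dampingWeight (p : ℝ → ℝ) (t : ℝ) : ℝ :=
  Real.exp ((1 / 2) * ∫ τ in (0 : ℝ)..t, p τ)

end

/-! ### Integrals on the half-line: little-o estimates and Grönwall. -/

section HalfLine

/-! Write n = x' + (p - ω²)x - y₁ and z = x - y₂. The rough forcing f cancels in n' = -ω²n + (p' +
ω²p - ω⁴ - ω²)x, and z' = n + (ω² - p)z + (2ω² - p)y₂, so (z, n) is a linear system driven by the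
continuous function y₂ alone.

Put U = Az, V = A(n + ω²z - pz/2) and η = e^{-iωt}(V + iωU). The weight A removes the damping and
the phase removes the rotation. What is left (`IsSlowDamping.amplitude_eq`) is η = ∫ e^{-iωs}A(p²/4
+ p'/2)z + κ∫ e^{-iωs}A y₂ + remainder, with κ = ω⁴ - ω² + 2iω³ ≠ 0. The kernel of the first
integral is A times an integrable function, and every term of the remainder has a factor p, p' or
p². Since ∫Ap = 2(A - 1) and |p'| + p² is integrable, the remainder is o(A) once y₂ → 0.

If x → 0, variation of constants gives n → 0, then z → 0 and hence y₂ → 0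
(`tendsto_filteredForcing₂`). So η and all other terms are o(A), and dividing by κ gives the
conditions on the cosine and sine integrals. Conversely, those conditions bound |η| by o(A) plus an
integral of |η| against an integrable kernel. Grönwall yields η = o(A), and |ω|A|z| ≤ |η| gives z →
0, so x = z + y₂ → 0. -/

theorem ContinuousOn.intervalIntegrable_of_Ici {E : Type*} [NormedAddCommGroup E] {g : ℝ → E}
    (hg : ContinuousOn g (Ici 0))
    {a b : ℝ} (ha : 0 ≤ a) (hb : 0 ≤ b) : IntervalIntegrable g volume a b :=
  (hg.mono fun _ hx => (le_min ha hb).trans hx.1).intervalIntegrable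

variable {E : Type*} [NormedAddCommGroup E] [NormedSpace ℝ E]

theorem continuousOn_primitive_Ici {g : ℝ → E}
    (hg : ∀ t, 0 ≤ t → IntervalIntegrable g volume 0 t) :
    ContinuousOn (fun t => ∫ s in (0 : ℝ)..t, g s) (Ici 0) := by
  intro t ht
  have ht' : (0 : ℝ) ≤ t + 1 := add_nonneg ht zero_le_one
  have h := intervalIntegral.continuousOn_primitive_interval' (hg (t + 1) ht') left_mem_uIcc
  rw [uIcc_of_le ht'] at h
  have hmem : Icc 0 (t + 1) ∈ 𝓝[Ici 0] t := by
    rw [← Ici_inter_Iic]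
    exact inter_mem self_mem_nhdsWithin
      (mem_nhdsWithin_of_mem_nhds (Iic_mem_nhds (lt_add_one t)))
  exact (h t ⟨ht, (lt_add_one t).le⟩).mono_of_mem_nhdsWithin hmem

theorem ContinuousOn.hasDerivAt_primitive_Ici [CompleteSpace E] {g : ℝ → E}
    (hg : ContinuousOn g (Ici 0)) {t : ℝ} (ht : 0 < t) :
    HasDerivAt (fun u => ∫ s in (0 : ℝ)..u, g s) (g t) t := by
  refine intervalIntegral.integral_hasDerivAt_right
    (hg.intervalIntegrable_of_Ici le_rfl ht.le) ?_ (hg.continuousAt (Ici_mem_nhds ht))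
  exact (hg.mono Ioi_subset_Ici_self).stronglyMeasurableAtFilter isOpen_Ioi t ht

theorem integral_eq_sub_of_hasDerivAt_Ici [CompleteSpace E] {F g : ℝ → E}
    (hF : ContinuousOn F (Ici 0)) (hg : ContinuousOn g (Ici 0))
    (hd : ∀ t, 0 < t → HasDerivAt F (g t) t) {t : ℝ} (ht : 0 ≤ t) :
    ∫ s in (0 : ℝ)..t, g s = F t - F 0 :=
  intervalIntegral.integral_eq_sub_of_hasDerivAt_of_le ht (hF.mono Icc_subset_Ici_self)
    (fun s hs => hd s hs.1) (hg.intervalIntegrable_of_Ici le_rfl ht)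

/-- If `y` tends to zero and the mass of `c` on `[0, t]` is `O(B t)` with `B → ∞`, then
`∫₀ᵗ y c` is `o(B t)`. -/
theorem isLittleO_integral_smul {B y : ℝ → ℝ} {c : ℝ → E} (hB : Tendsto B atTop atTop)
    (hc : ContinuousOn c (Ici 0)) (hyc : ContinuousOn y (Ici 0)) (hy : Tendsto y atTop (𝓝 0))
    (hcB : (fun t => ∫ s in (0 : ℝ)..t, ‖c s‖) =O[atTop] B) :
    (fun t => ∫ s in (0 : ℝ)..t, y s • c s) =o[atTop] B := by
  obtain ⟨C, hC, hCB⟩ := hcB.exists_pos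
  rw [isLittleO_iff]
  intro ε hε
  -- Half of ε pays for the tail beyond T; the other half absorbs the fixed head K once B t ≥ 2K/ε.
  have hδ : 0 < ε / (2 * C) := by positivity
  obtain ⟨T, hT0, hT⟩ : ∃ T, 0 ≤ T ∧ ∀ t, T ≤ t → ‖y t‖ ≤ ε / (2 * C) := by
    obtain ⟨T, hT⟩ := eventually_atTop.1 (hy.norm.eventually_le_const (by simpa using hδ))
    exact ⟨max T 0, le_max_right _ _, fun t ht => hT t ((le_max_left _ _).trans ht)⟩
  set K := ‖∫ s in (0 : ℝ)..T, y s • c s‖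
  filter_upwards [hCB.bound, hB.eventually_ge_atTop (2 * K / ε), hB.eventually_ge_atTop 0,
    eventually_ge_atTop T] with t h1 h2 h3 h4
  have ht0 := hT0.trans h4
  have hi := hyc.smul hc
  have hn : 0 ≤ ∫ s in (0 : ℝ)..T, ‖c s‖ :=
    intervalIntegral.integral_nonneg hT0 fun _ _ => norm_nonneg _
  have hsplit := intervalIntegral.integral_add_adjacent_intervals
    (hc.norm.intervalIntegrable_of_Ici le_rfl hT0) (hc.norm.intervalIntegrable_of_Ici hT0 ht0)
  have hsplit' := intervalIntegral.integral_add_adjacent_intervals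
    (hi.intervalIntegrable_of_Ici le_rfl hT0) (hi.intervalIntegrable_of_Ici hT0 ht0)
  have htail : ‖∫ s in T..t, y s • c s‖ ≤ ∫ s in T..t, ε / (2 * C) * ‖c s‖ := by
    refine intervalIntegral.norm_integral_le_of_norm_le h4 (ae_of_all _ fun s hs => ?_)
      ((hc.norm.intervalIntegrable_of_Ici hT0 ht0).const_mul _)
    rw [norm_smul]
    exact mul_le_mul_of_nonneg_right (hT s hs.1.le) (norm_nonneg _)
  rw [intervalIntegral.integral_const_mul] at htail
  rw [Real.norm_of_nonneg h3] at h1 ⊢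
  have h1' := (le_abs_self _).trans h1
  have h5 : ε / (2 * C) * ∫ s in T..t, ‖c s‖ ≤ ε / (2 * C) * (C * B t) :=
    mul_le_mul_of_nonneg_left (by linarith) hδ.le
  have h6 : ε / (2 * C) * (C * B t) = ε * B t / 2 := by field_simp
  have h7 : K ≤ ε * B t / 2 := by
    rw [div_le_iff₀ hε] at h2
    linarith
  have hdef : (∫ s in (0 : ℝ)..T, (y • c) s) = ∫ s in (0 : ℝ)..T, y s • c s := rfl
  have hdef' : (∫ s in T..t, (y • c) s) = ∫ s in T..t, y s • c s := rfl
  have hdef'' : (∫ s in (0 : ℝ)..t, (y • c) s) = ∫ s in (0 : ℝ)..t, y s • c s := rfl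
  rw [← hdef'', ← hsplit', hdef, hdef']
  calc _ ≤ K + ‖∫ s in T..t, y s • c s‖ := norm_add_le _ _
    _ ≤ ε * B t := by linarith

/-- Grönwall's inequality in integral form, with a variable kernel. -/
theorem le_mul_exp_of_le_add_integral {g k : ℝ → ℝ} {K t : ℝ} (ht : 0 ≤ t)
    (hg : ContinuousOn g (Ici 0)) (hk : ContinuousOn k (Ici 0)) (hk0 : ∀ s, 0 ≤ s → 0 ≤ k s)
    (h : ∀ s ∈ Icc 0 t, g s ≤ K + ∫ u in (0 : ℝ)..s, k u * g u) :
    g t ≤ K * Real.exp (∫ u in (0 : ℝ)..t, k u) := by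
  have hkg := hk.mul hg
  set P : ℝ → ℝ := fun s => ∫ u in (0 : ℝ)..s, k u
  -- The right-hand side of the inequality times its integrating factor. The hypothesis makes this
  -- antitone, with no sign condition on g or K.
  set G : ℝ → ℝ := fun s => (K + ∫ u in (0 : ℝ)..s, k u * g u) * Real.exp (-P s)
  have hPc : ContinuousOn P (Ici 0) :=
    continuousOn_primitive_Ici fun s hs => hk.intervalIntegrable_of_Ici le_rfl hs
  have hGc : ContinuousOn G (Ici 0) :=
    (continuousOn_const.add (continuousOn_primitive_Ici fun s hs =>
      hkg.intervalIntegrable_of_Ici le_rfl hs)).mul hPc.neg.rexp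
  have hGd : ∀ s, 0 < s → HasDerivAt G
      (k s * g s * Real.exp (-P s) +
        (K + ∫ u in (0 : ℝ)..s, k u * g u) * (Real.exp (-P s) * -k s)) s := fun s hs =>
    ((hkg.hasDerivAt_primitive_Ici hs).const_add K).mul
      (hk.hasDerivAt_primitive_Ici hs).neg.exp
  have hanti : AntitoneOn G (Icc 0 t) := by
    refine antitoneOn_of_hasDerivWithinAt_nonpos (convex_Icc 0 t)
      (hGc.mono Icc_subset_Ici_self)
      (fun s hs => (hGd s (interior_Icc (a := (0 : ℝ)) (b := t) ▸ hs).1).hasDerivWithinAt)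
      fun s hs => ?_
    rw [interior_Icc] at hs
    have := h s ⟨hs.1.le, hs.2.le⟩
    have h2 : 0 ≤ Real.exp (-P s) * k s := mul_nonneg (Real.exp_pos _).le (hk0 s hs.1.le)
    nlinarith [mul_le_mul_of_nonneg_left this h2]
  have h0 : G t ≤ G 0 := hanti (left_mem_Icc.2 ht) (right_mem_Icc.2 ht) ht
  have h1 : G 0 = K := by simp [G, P]
  have h2 := mul_le_mul_of_nonneg_right (h0.trans_eq h1) (Real.exp_pos (P t)).le
  have h3 : G t * Real.exp (P t) = K + ∫ u in (0 : ℝ)..t, k u * g u := by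
    simp only [G]
    rw [mul_assoc, ← Real.exp_add, neg_add_cancel, Real.exp_zero, mul_one]
  rw [h3] at h2
  exact (h t (right_mem_Icc.2 ht)).trans h2

/-- Grönwall's inequality transfers `o(B)` bounds along integral inequalities with integrable
kernel when `B` is monotone and unbounded. -/
theorem isLittleO_of_norm_le_add_integral {F G : Type*} [NormedAddCommGroup F]
    [NormedAddCommGroup G] {B k : ℝ → ℝ} {η : ℝ → G} {h : ℝ → F} {Q : ℝ}
    (hB : Tendsto B atTop atTop) (hBm : MonotoneOn B (Ici 0)) (hB0 : ∀ t, 0 ≤ t → 0 ≤ B t)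
    (hη : ContinuousOn η (Ici 0)) (hhc : ContinuousOn h (Ici 0))
    (hk : ContinuousOn k (Ici 0)) (hk0 : ∀ s, 0 ≤ s → 0 ≤ k s)
    (hQ : ∀ t, 0 ≤ t → ∫ s in (0 : ℝ)..t, k s ≤ Q) (hh : h =o[atTop] B)
    (hle : ∀ t, 0 ≤ t → ‖η t‖ ≤ ‖h t‖ + ∫ s in (0 : ℝ)..t, k s * ‖η s‖) :
    η =o[atTop] B := by
  rw [isLittleO_iff] at hh ⊢
  intro ε hε
  -- Grönwall costs a factor of at most exp Q; the 2 leaves room to absorb the bound for h on [0,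
  -- T].
  set δ := ε * Real.exp (-Q) / 2 with hδdef
  have hδ : 0 < δ := by positivity
  obtain ⟨T, hT⟩ := eventually_atTop.1 (hh hδ)
  have hhT : ContinuousOn h (Icc 0 T) := hhc.mono Icc_subset_Ici_self
  obtain ⟨C, hC⟩ := isCompact_Icc.exists_bound_of_continuousOn hhT
  have hbound : ∀ s, 0 ≤ s → ‖h s‖ ≤ max C 0 + δ * B s := by
    intro s hs
    rcases le_total s T with h1 | h1
    · exact (hC s ⟨hs, h1⟩).trans ((le_max_left _ _).trans
        (le_add_of_nonneg_right (mul_nonneg hδ.le (hB0 s hs))))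
    · have := hT s h1
      rw [Real.norm_of_nonneg (hB0 s hs)] at this
      exact this.trans (le_add_of_nonneg_left (le_max_right _ _))
  filter_upwards [hB.eventually_ge_atTop (max C 0 / δ), eventually_ge_atTop 0] with t h1 ht
  rw [Real.norm_of_nonneg (hB0 t ht)]
  -- Freezing B at the right endpoint, allowed by monotonicity, makes the constant in Grönwall
  -- independent of s.
  have hG := le_mul_exp_of_le_add_integral (g := fun s => ‖η s‖) (K := max C 0 + δ * B t) ht
    hη.norm hk hk0 fun s hs => (hle s hs.1).trans (by
      have h3 := mul_le_mul_of_nonneg_left (hBm hs.1 ht hs.2) hδ.le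
      have h4 := hbound s hs.1
      linarith)
  rw [div_le_iff₀ hδ] at h1
  calc ‖η t‖ ≤ (max C 0 + δ * B t) * Real.exp (∫ u in (0 : ℝ)..t, k u) := hG
    _ ≤ (2 * δ * B t) * Real.exp Q := by
      have := mul_nonneg hδ.le (hB0 t ht)
      exact mul_le_mul (by linarith) (Real.exp_le_exp.2 (hQ t ht)) (Real.exp_pos _).le
        (by linarith)
    _ = ε * B t * (Real.exp (-Q) * Real.exp Q) := by rw [hδdef]; ring
    _ = ε * B t := by rw [← Real.exp_add, neg_add_cancel, Real.exp_zero, mul_one]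

/-- Solutions of `n' = -a n + g y` decay when `a > 0`, `y → 0`, and `g` is the sum of a bounded and an
integrable function. -/
theorem tendsto_zero_of_exp_mul_eq_integral {n y g w : ℝ → ℝ} {a C Q : ℝ}
    (ha : 0 < a)
    (hg : ContinuousOn g (Ici 0)) (hy : ContinuousOn y (Ici 0)) (hw : ContinuousOn w (Ici 0))
    (hgw : ∀ t, 0 ≤ t → ‖g t‖ ≤ C + w t) (hw0 : ∀ t, 0 ≤ t → 0 ≤ w t)
    (hwQ : ∀ t, 0 ≤ t → ∫ s in (0 : ℝ)..t, w s ≤ Q)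
    (hn : ∀ t, 0 ≤ t → Real.exp (a * t) * n t = ∫ s in (0 : ℝ)..t, y s * (Real.exp (a * s) * g s))
    (hy0 : Tendsto y atTop (𝓝 0)) : Tendsto n atTop (𝓝 0) := by
  have hexp : Continuous fun s : ℝ => Real.exp (a * s) := by fun_prop
  have hB : Tendsto (fun t : ℝ => Real.exp (a * t)) atTop atTop :=
    Real.tendsto_exp_atTop.comp (tendsto_id.const_mul_atTop ha)
  have hc : ContinuousOn (fun s => Real.exp (a * s) * g s) (Ici 0) := hexp.continuousOn.mul hg
  have hO : (fun t => ∫ s in (0 : ℝ)..t, ‖Real.exp (a * s) * g s‖) =O[atTop]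
      fun t => Real.exp (a * t) := by
    refine IsBigO.of_bound (|C| / a + Q) ?_
    filter_upwards [eventually_ge_atTop 0] with t ht
    rw [Real.norm_of_nonneg (intervalIntegral.integral_nonneg ht fun _ _ => norm_nonneg _),
      Real.norm_of_nonneg (Real.exp_pos _).le]
    have i1 : IntervalIntegrable (fun s => |C| * Real.exp (a * s)) volume 0 t :=
      (hexp.const_mul _).intervalIntegrable _ _
    have i2 : IntervalIntegrable (fun s => Real.exp (a * t) * w s) volume 0 t :=
      (hw.intervalIntegrable_of_Ici le_rfl ht).const_mul _
    have hexpint : ∫ s in (0 : ℝ)..t, Real.exp (a * s) = (Real.exp (a * t) - 1) / a := by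
      rw [intervalIntegral.integral_comp_mul_left (fun s => Real.exp s) ha.ne', integral_exp]
      simp [div_eq_inv_mul]
    calc ∫ s in (0 : ℝ)..t, ‖Real.exp (a * s) * g s‖
        ≤ ∫ s in (0 : ℝ)..t, (|C| * Real.exp (a * s) + Real.exp (a * t) * w s) := by
          refine intervalIntegral.integral_mono_on ht
            (hc.norm.intervalIntegrable_of_Ici le_rfl ht) (i1.add i2) fun s hs => ?_
          rw [norm_mul, Real.norm_of_nonneg (Real.exp_pos _).le]
          have e1 : Real.exp (a * s) ≤ Real.exp (a * t) :=
            Real.exp_le_exp.2 (mul_le_mul_of_nonneg_left hs.2 ha.le)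
          have e2 := mul_le_mul_of_nonneg_right e1 (hw0 s hs.1)
          have e3 := mul_le_mul_of_nonneg_left (hgw s hs.1) (Real.exp_pos (a * s)).le
          have e4 := mul_le_mul_of_nonneg_left (le_abs_self C) (Real.exp_pos (a * s)).le
          linarith
      _ = |C| * ((Real.exp (a * t) - 1) / a) + Real.exp (a * t) * ∫ s in (0 : ℝ)..t, w s := by
          rw [intervalIntegral.integral_add i1 i2, intervalIntegral.integral_const_mul,
            intervalIntegral.integral_const_mul, hexpint]
      _ ≤ (|C| / a + Q) * Real.exp (a * t) := by
          have e1 := mul_le_mul_of_nonneg_left (hwQ t ht) (Real.exp_pos (a * t)).le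
          have e2 : |C| * ((Real.exp (a * t) - 1) / a) = |C| / a * Real.exp (a * t) - |C| / a := by
            ring
          have : 0 ≤ |C| / a := by positivity
          linarith
  have := isLittleO_integral_smul hB hc hy hy0 hO
  rw [isLittleO_iff_tendsto' (Eventually.of_forall fun t h => absurd h (Real.exp_pos _).ne')] at this
  refine this.congr' ?_
  filter_upwards [eventually_ge_atTop 0] with t ht
  simp only [smul_eq_mul]
  rw [← hn t ht, mul_div_cancel_left₀ _ (Real.exp_pos _).ne']

end HalfLine

/-! ### Slow damping and the weight A. -/

/-- Damping coefficients that decrease slowly to zero: positive, `C¹`, decreasing, square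
integrable but not integrable on `[0, ∞)`. -/
structure IsSlowDamping (p : ℝ → ℝ) : Prop where
  contDiffOn : ContDiffOn ℝ 1 p (Ici 0)
  pos : ∀ t : ℝ, 0 ≤ t → 0 < p t
  deriv_neg : ∀ t : ℝ, 0 ≤ t → derivWithin p (Ici 0) t < 0
  not_integrable : ¬ IntegrableOn p (Ioi 0) volume
  sq_integrable : IntegrableOn (fun t => p t ^ 2) (Ioi 0) volume

/-- The integrable function `|p'| + p²` controlling the perturbation of the harmonic oscillator. -/
noncomputable def dampingVariation (p : ℝ → ℝ) (t : ℝ) : ℝ :=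
  |derivWithin p (Ici 0) t| + p t ^ 2

namespace IsSlowDamping

variable {p : ℝ → ℝ}

theorem continuousOn (hp : IsSlowDamping p) : ContinuousOn p (Ici 0) :=
  hp.contDiffOn.continuousOn

theorem continuousOn_deriv (hp : IsSlowDamping p) : ContinuousOn (derivWithin p (Ici 0)) (Ici 0) :=
  hp.contDiffOn.continuousOn_derivWithin (uniqueDiffOn_Ici 0) le_rfl

theorem hasDerivAt (hp : IsSlowDamping p) {t : ℝ} (ht : 0 < t) :
    HasDerivAt p (derivWithin p (Ici 0) t) t :=
  ((hp.contDiffOn.differentiableOn one_ne_zero) t ht.le).hasDerivWithinAt.hasDerivAt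
    (Ici_mem_nhds ht)

theorem integral_deriv (hp : IsSlowDamping p) {t : ℝ} (ht : 0 ≤ t) :
    ∫ s in (0 : ℝ)..t, derivWithin p (Ici 0) s = p t - p 0 :=
  integral_eq_sub_of_hasDerivAt_Ici hp.continuousOn hp.continuousOn_deriv
    (fun _ => hp.hasDerivAt) ht

theorem integral_abs_deriv (hp : IsSlowDamping p) {t : ℝ} (ht : 0 ≤ t) :
    ∫ s in (0 : ℝ)..t, |derivWithin p (Ici 0) s| = p 0 - p t := by
  have : ∫ s in (0 : ℝ)..t, |derivWithin p (Ici 0) s|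
      = ∫ s in (0 : ℝ)..t, -derivWithin p (Ici 0) s :=
    intervalIntegral.integral_congr fun s hs => by
      rw [uIcc_of_le ht] at hs
      exact abs_of_neg (hp.deriv_neg s hs.1)
  rw [this, intervalIntegral.integral_neg, hp.integral_deriv ht, neg_sub]

theorem le_zero (hp : IsSlowDamping p) {t : ℝ} (ht : 0 ≤ t) : p t ≤ p 0 := by
  have h : 0 ≤ ∫ s in (0 : ℝ)..t, |derivWithin p (Ici 0) s| :=
    intervalIntegral.integral_nonneg ht fun _ _ => abs_nonneg _
  rw [hp.integral_abs_deriv ht] at h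
  linarith

/-- A decreasing function has variation equal to its drop, and positivity of p caps that drop
uniformly in t. -/
theorem integral_abs_deriv_le (hp : IsSlowDamping p) {t : ℝ} (ht : 0 ≤ t) :
    ∫ s in (0 : ℝ)..t, |derivWithin p (Ici 0) s| ≤ p 0 := by
  rw [hp.integral_abs_deriv ht]
  linarith [hp.pos t ht]

theorem continuousOn_variation (hp : IsSlowDamping p) : ContinuousOn (dampingVariation p) (Ici 0) :=
  hp.continuousOn_deriv.abs.add (hp.continuousOn.pow 2)

theorem exists_integral_variation_le (hp : IsSlowDamping p) :
    ∃ Q, ∀ t, 0 ≤ t → ∫ s in (0 : ℝ)..t, dampingVariation p s ≤ Q := by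
  refine ⟨p 0 + ∫ s in Ioi (0 : ℝ), p s ^ 2, fun t ht => ?_⟩
  have hsq : ContinuousOn (fun s => p s ^ 2) (Ici 0) := hp.continuousOn.pow 2
  unfold dampingVariation
  rw [intervalIntegral.integral_add
    (hp.continuousOn_deriv.abs.intervalIntegrable_of_Ici le_rfl ht)
    (hsq.intervalIntegrable_of_Ici le_rfl ht)]
  refine add_le_add (hp.integral_abs_deriv_le ht) ?_
  rw [intervalIntegral.integral_of_le ht]
  exact setIntegral_mono_set hp.sq_integrable (ae_of_all _ fun s => sq_nonneg _)
    Ioc_subset_Ioi_self.eventuallyLE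

/-- The primitive of a positive function is monotone, so if it did not diverge it would be bounded
and p would be integrable. -/
theorem tendsto_integral (hp : IsSlowDamping p) :
    Tendsto (fun t => ∫ s in (0 : ℝ)..t, p s) atTop atTop := by
  have hmono : MonotoneOn (fun t => ∫ s in (0 : ℝ)..t, p s) (Ici 0) := by
    intro s hs t ht hst
    have h := intervalIntegral.integral_add_adjacent_intervals
      (hp.continuousOn.intervalIntegrable_of_Ici le_rfl hs)
      (hp.continuousOn.intervalIntegrable_of_Ici hs ht)
    have h' : 0 ≤ ∫ u in s..t, p u := intervalIntegral.integral_nonneg hst fun u hu =>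
      (hp.pos u (le_trans hs hu.1)).le
    simp only
    linarith
  by_contra hcon
  obtain ⟨b, hb⟩ : ∃ b, ∀ t, 0 ≤ t → ∫ s in (0 : ℝ)..t, p s ≤ b := by
    by_contra! H
    refine hcon (tendsto_atTop.2 fun b => ?_)
    obtain ⟨T, hT, hbT⟩ := H b
    filter_upwards [eventually_ge_atTop T] with t ht
    exact hbT.le.trans (hmono hT (le_trans hT ht) ht)
  refine hp.not_integrable (integrableOn_Ioi_of_intervalIntegral_norm_bounded (l := atTop)
    (b := fun t : ℝ => t) b 0 (fun t => ?_) tendsto_id ?_)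
  · rcases le_total 0 t with ht | ht
    · exact (intervalIntegrable_iff_integrableOn_Ioc_of_le ht).1
        (hp.continuousOn.intervalIntegrable_of_Ici le_rfl ht)
    · rw [Ioc_eq_empty (not_lt.2 ht)]
      exact integrableOn_empty
  · filter_upwards [eventually_ge_atTop 0] with t ht
    refine le_trans (le_of_eq (intervalIntegral.integral_congr fun s hs => ?_)) (hb t ht)
    rw [uIcc_of_le ht] at hs
    exact Real.norm_of_nonneg (hp.pos s hs.1).le

theorem dampingWeight_pos (t : ℝ) : 0 < dampingWeight p t := Real.exp_pos _

theorem tendsto_dampingWeight (hp : IsSlowDamping p) : Tendsto (dampingWeight p) atTop atTop :=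
  Real.tendsto_exp_atTop.comp (hp.tendsto_integral.const_mul_atTop (by norm_num))

theorem continuousOn_dampingWeight (hp : IsSlowDamping p) : ContinuousOn (dampingWeight p) (Ici 0) :=
  (continuousOn_const.mul (continuousOn_primitive_Ici fun _ ht =>
    hp.continuousOn.intervalIntegrable_of_Ici le_rfl ht)).rexp

theorem hasDerivAt_dampingWeight (hp : IsSlowDamping p) {t : ℝ} (ht : 0 < t) :
    HasDerivAt (dampingWeight p) (dampingWeight p t * (p t / 2)) t := by
  convert! ((hp.continuousOn.hasDerivAt_primitive_Ici ht).const_mul (1 / 2)).exp using 1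
  simp only [dampingWeight]
  ring

theorem monotoneOn_dampingWeight (hp : IsSlowDamping p) : MonotoneOn (dampingWeight p) (Ici 0) := by
  refine monotoneOn_of_hasDerivWithinAt_nonneg (convex_Ici 0) hp.continuousOn_dampingWeight
    (f' := fun t => dampingWeight p t * (p t / 2)) (fun t ht => ?_) fun t ht => ?_
  · rw [interior_Ici] at ht ⊢
    exact (hp.hasDerivAt_dampingWeight ht).hasDerivWithinAt
  · rw [interior_Ici] at ht
    exact mul_nonneg (dampingWeight_pos t).le (half_pos (hp.pos t ht.le)).le

/-- Ap is the exact derivative of 2A, so p may appear here although it is not integrable. For the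
integrable part, A is replaced by its value at the right endpoint. -/
theorem isBigO_integral_norm (hp : IsSlowDamping p) {E : Type*} [NormedAddCommGroup E]
    {c : ℝ → E} {C : ℝ}
    (hC : 0 ≤ C) (hc : ContinuousOn c (Ici 0))
    (hbound : ∀ t, 0 ≤ t → ‖c t‖ ≤ dampingWeight p t * (C * p t + dampingVariation p t)) :
    (fun t => ∫ s in (0 : ℝ)..t, ‖c s‖) =O[atTop] dampingWeight p := by
  obtain ⟨Q, hQ⟩ := hp.exists_integral_variation_le
  refine IsBigO.of_bound (2 * C + Q) ?_
  filter_upwards [eventually_ge_atTop 0] with t ht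
  rw [Real.norm_of_nonneg (intervalIntegral.integral_nonneg ht fun _ _ => norm_nonneg _),
    Real.norm_of_nonneg (dampingWeight_pos t).le]
  have cA := hp.continuousOn_dampingWeight.mul
    (hp.continuousOn.div_const 2)
  have i1 : IntervalIntegrable (fun s => 2 * C * (dampingWeight p s * (p s / 2))) volume 0 t :=
    (cA.intervalIntegrable_of_Ici le_rfl ht).const_mul _
  have i2 : IntervalIntegrable (fun s => dampingWeight p t * dampingVariation p s) volume 0 t :=
    (hp.continuousOn_variation.intervalIntegrable_of_Ici le_rfl ht).const_mul _
  have hA : ∫ s in (0 : ℝ)..t, dampingWeight p s * (p s / 2)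
      = dampingWeight p t - dampingWeight p 0 :=
    integral_eq_sub_of_hasDerivAt_Ici hp.continuousOn_dampingWeight cA
      (fun _ => hp.hasDerivAt_dampingWeight) ht
  have hA0 := dampingWeight_pos (p := p) 0
  calc ∫ s in (0 : ℝ)..t, ‖c s‖
      ≤ ∫ s in (0 : ℝ)..t, (2 * C * (dampingWeight p s * (p s / 2))
          + dampingWeight p t * dampingVariation p s) := by
        refine intervalIntegral.integral_mono_on ht
          (hc.norm.intervalIntegrable_of_Ici le_rfl ht) (i1.add i2) fun s hs => ?_
        have h1 := hp.monotoneOn_dampingWeight hs.1 ht hs.2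
        have h2 : 0 ≤ dampingVariation p s := by unfold dampingVariation; positivity
        have h3 := mul_le_mul_of_nonneg_right h1 h2
        have h4 := hbound s hs.1
        linarith
    _ = 2 * C * (dampingWeight p t - dampingWeight p 0)
          + dampingWeight p t * ∫ s in (0 : ℝ)..t, dampingVariation p s := by
        rw [intervalIntegral.integral_add i1 i2, intervalIntegral.integral_const_mul,
          intervalIntegral.integral_const_mul, hA]
    _ ≤ (2 * C + Q) * dampingWeight p t := by
        have h1 := mul_le_mul_of_nonneg_left (hQ t ht) (dampingWeight_pos (p := p) t).le
        have h2 := mul_nonneg hC hA0.le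
        linarith

end IsSlowDamping

/-! ### Rotating coordinates and the amplitude equation. -/

/-- The rotating phase `e^{-iωt}`. -/
noncomputable def phase (ω t : ℝ) : ℂ := Complex.exp (-(ω * t * Complex.I))

theorem norm_phase (ω t : ℝ) : ‖phase ω t‖ = 1 := by
  have : -((ω : ℂ) * t * Complex.I) = ((-(ω * t) : ℝ) : ℂ) * Complex.I := by push_cast; ring
  rw [phase, this, Complex.norm_exp_ofReal_mul_I]

theorem hasDerivAt_phase (ω t : ℝ) :
    HasDerivAt (phase ω) (phase ω t * -(ω * Complex.I)) t := by
  have h : HasDerivAt (fun s : ℝ => -((ω : ℂ) * s * Complex.I)) (-(ω * 1 * Complex.I)) t :=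
    (((hasDerivAt_id t).ofReal_comp.const_mul (ω : ℂ)).mul_const Complex.I).neg
  have h2 := h.cexp
  rw [mul_one] at h2
  exact h2

theorem continuous_phase (ω : ℝ) : Continuous (phase ω) :=
  continuous_iff_continuousAt.2 fun t => (hasDerivAt_phase ω t).continuousAt

theorem phase_eq_cos_sub_sin (ω t : ℝ) :
    phase ω t = ((Real.cos (ω * t) : ℝ) : ℂ) - Complex.I * ((Real.sin (ω * t) : ℝ) : ℂ) := by
  have : -((ω : ℂ) * t * Complex.I) = (((-(ω * t) : ℝ)) : ℂ) * Complex.I := by push_cast; ring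
  rw [phase, this, Complex.exp_mul_I, ← Complex.ofReal_cos, ← Complex.ofReal_sin, Real.cos_neg,
    Real.sin_neg]
  push_cast
  ring

/-- The Fourier-type integral is small relative to `B` exactly when its cosine and sine parts
are. -/
theorem isLittleO_integral_phase_iff {ω : ℝ} {A B y : ℝ → ℝ} (hA : ContinuousOn A (Ici 0))
    (hy : ContinuousOn y (Ici 0)) :
    ((fun t => ∫ s in (0 : ℝ)..t, y s • (phase ω s * A s)) =o[atTop] B) ↔
      ((fun t => ∫ s in (0 : ℝ)..t, Real.cos (ω * s) * A s * y s) =o[atTop] B) ∧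
      ((fun t => ∫ s in (0 : ℝ)..t, Real.sin (ω * s) * A s * y s) =o[atTop] B) := by
  have hcos : ContinuousOn (fun s => Real.cos (ω * s) * A s * y s) (Ici 0) :=
    ((Continuous.continuousOn (by fun_prop)).mul hA).mul hy
  have hsin : ContinuousOn (fun s => Real.sin (ω * s) * A s * y s) (Ici 0) :=
    ((Continuous.continuousOn (by fun_prop)).mul hA).mul hy
  have hsplit : ∀ t, 0 ≤ t → ∫ s in (0 : ℝ)..t, y s • (phase ω s * A s)
      = ((∫ s in (0 : ℝ)..t, Real.cos (ω * s) * A s * y s : ℝ) : ℂ)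
        - Complex.I * ((∫ s in (0 : ℝ)..t, Real.sin (ω * s) * A s * y s : ℝ) : ℂ) := by
    intro t ht
    rw [← intervalIntegral.integral_ofReal, ← intervalIntegral.integral_ofReal,
      ← intervalIntegral.integral_const_mul, ← intervalIntegral.integral_sub]
    · refine intervalIntegral.integral_congr fun s _ => ?_
      simp only [phase_eq_cos_sub_sin, Complex.real_smul]
      push_cast
      ring
    · exact (Complex.continuous_ofReal.comp_continuousOn hcos).intervalIntegrable_of_Ici le_rfl ht
    · exact ((Complex.continuous_ofReal.comp_continuousOn hsin).intervalIntegrable_of_Ici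
        le_rfl ht).const_mul _
  have hev : (fun t => ∫ s in (0 : ℝ)..t, y s • (phase ω s * A s)) =ᶠ[atTop] fun t =>
      ((∫ s in (0 : ℝ)..t, Real.cos (ω * s) * A s * y s : ℝ) : ℂ)
        - Complex.I * ((∫ s in (0 : ℝ)..t, Real.sin (ω * s) * A s * y s : ℝ) : ℂ) := by
    filter_upwards [eventually_ge_atTop 0] with t ht using hsplit t ht
  rw [isLittleO_congr hev EventuallyEq.rfl]
  constructor
  · intro h
    refine ⟨(IsBigO.of_norm_le fun t => ?_).trans_isLittleO h.norm_left,
      (IsBigO.of_norm_le fun t => ?_).trans_isLittleO h.norm_left⟩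
    · rw [Real.norm_eq_abs]
      refine le_of_eq_of_le ?_ (Complex.abs_re_le_norm _)
      simp
    -- The sine integral is minus the imaginary part.
    · rw [Real.norm_eq_abs, ← abs_neg]
      refine le_of_eq_of_le ?_ (Complex.abs_im_le_norm _)
      simp
  · rintro ⟨h1, h2⟩
    refine IsLittleO.sub ?_ (IsLittleO.const_mul_left ?_ _)
    · exact IsLittleO.of_norm_left (by simpa using h1.norm_left)
    · exact IsLittleO.of_norm_left (by simpa using h2.norm_left)

/-- The amplitude equation: the system for `(z, n)` in rotating coordinates. -/
theorem IsSlowDamping.amplitude_eq {p z n y : ℝ → ℝ} (hp : IsSlowDamping p) {ω : ℝ}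
    (hz : ContinuousOn z (Ici 0)) (hn : ContinuousOn n (Ici 0)) (hy : ContinuousOn y (Ici 0))
    (hz0 : z 0 = 0) (hn0 : n 0 = 0)
    (hzd : ∀ t, 0 < t → HasDerivAt z
      (n t + (ω ^ 2 - p t) * z t + (2 * ω ^ 2 - p t) * y t) t)
    (hnd : ∀ t, 0 < t → HasDerivAt n (-ω ^ 2 * n t +
      (derivWithin p (Ici 0) t + ω ^ 2 * p t - ω ^ 4 - ω ^ 2) * (z t + y t)) t)
    {t : ℝ} (ht : 0 ≤ t) :
    phase ω t * ((dampingWeight p t * (n t + ω ^ 2 * z t - p t / 2 * z t) : ℝ)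
        + Complex.I * (ω * (dampingWeight p t * z t) : ℝ))
      = (∫ s in (0 : ℝ)..t, z s • (phase ω s * (dampingWeight p s *
            (p s ^ 2 / 4 + derivWithin p (Ici 0) s / 2) : ℝ)))
        + ((ω ^ 4 - ω ^ 2 : ℝ) + Complex.I * (2 * ω ^ 3 : ℝ))
          * (∫ s in (0 : ℝ)..t, y s • (phase ω s * dampingWeight p s))
        + ∫ s in (0 : ℝ)..t, y s • (phase ω s * ((dampingWeight p s *
            (derivWithin p (Ici 0) s - ω ^ 2 * p s + p s ^ 2 / 2) : ℝ)
            + Complex.I * (dampingWeight p s * (-(ω * p s)) : ℝ))) := by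
  set P := derivWithin p (Ici 0) with hP
  set A := dampingWeight p
  have cA : ContinuousOn A (Ici 0) := hp.continuousOn_dampingWeight
  have cp := hp.continuousOn
  have cP : ContinuousOn P (Ici 0) := hp.continuousOn_deriv
  have cph : ContinuousOn (phase ω) (Ici 0) := (continuous_phase ω).continuousOn
  have c1 : ContinuousOn (fun s => z s • (phase ω s * (A s *
      (p s ^ 2 / 4 + P s / 2) : ℝ))) (Ici 0) := by fun_prop
  have c2 : ContinuousOn (fun s => y s • (phase ω s * A s)) (Ici 0) := by fun_prop
  have c3 : ContinuousOn (fun s => y s • (phase ω s * ((A s *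
      (P s - ω ^ 2 * p s + p s ^ 2 / 2) : ℝ) + Complex.I * (A s * (-(ω * p s)) : ℝ))))
      (Ici 0) := by fun_prop
  rw [← intervalIntegral.integral_const_mul,
    ← intervalIntegral.integral_add (c1.intervalIntegrable_of_Ici le_rfl ht)
      ((c2.intervalIntegrable_of_Ici le_rfl ht).const_mul _),
    ← intervalIntegral.integral_add ((c1.intervalIntegrable_of_Ici le_rfl ht).add
      ((c2.intervalIntegrable_of_Ici le_rfl ht).const_mul _))
      (c3.intervalIntegrable_of_Ici le_rfl ht)]
  rw [integral_eq_sub_of_hasDerivAt_Ici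
    (F := fun t => phase ω t * ((A t * (n t + ω ^ 2 * z t - p t / 2 * z t) : ℝ)
        + Complex.I * (ω * (A t * z t) : ℝ))) (by fun_prop) (by fun_prop) (fun s hs => ?_) ht]
  · simp [hz0, hn0]
  · have dA : HasDerivAt A (A s * (p s / 2)) s := hp.hasDerivAt_dampingWeight hs
    have dp : HasDerivAt p (P s) s := hp.hasDerivAt hs
    have dz := hzd s hs
    have dV := dA.mul (((hnd s hs).add (dz.const_mul (ω ^ 2))).sub ((dp.div_const 2).mul dz))
    have dU := (dA.mul dz).const_mul ω
    have := (hasDerivAt_phase ω s).mul (dV.ofReal_comp.add (dU.ofReal_comp.const_mul Complex.I))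
    refine this.congr_deriv ?_
    simp only [Complex.real_smul, Pi.add_apply, Pi.sub_apply, Pi.mul_apply]
    push_cast
    -- The derivative of the phase cancels the -ω²U in V'; this is the only use of I² = -1.
    linear_combination (-(phase ω s) * ω^2 * A s * z s) * Complex.I_sq

/-! ### Decay criterion for the reduced system. -/

namespace IsSlowDamping

variable {p z n y : ℝ → ℝ} {ω : ℝ}

theorem isLittleO_integral_variation (hp : IsSlowDamping p)
    (hz : ContinuousOn z (Ici 0)) (hz0 : Tendsto z atTop (𝓝 0)) :
    (fun t => ∫ s in (0 : ℝ)..t, z s • (phase ω s * (dampingWeight p s *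
      (p s ^ 2 / 4 + derivWithin p (Ici 0) s / 2) : ℝ))) =o[atTop] dampingWeight p := by
  have cA := hp.continuousOn_dampingWeight
  have cp := hp.continuousOn
  have cP := hp.continuousOn_deriv
  have cph : ContinuousOn (phase ω) (Ici 0) := (continuous_phase ω).continuousOn
  have cc : ContinuousOn (fun s => phase ω s * (dampingWeight p s *
      (p s ^ 2 / 4 + derivWithin p (Ici 0) s / 2) : ℝ)) (Ici 0) := by fun_prop
  refine isLittleO_integral_smul hp.tendsto_dampingWeight cc hz hz0
    (hp.isBigO_integral_norm le_rfl cc fun t ht => ?_)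
  rw [norm_mul, norm_phase, one_mul, Complex.norm_real, norm_mul,
    Real.norm_of_nonneg (dampingWeight_pos t).le]
  refine mul_le_mul_of_nonneg_left ?_ (dampingWeight_pos t).le
  rw [Real.norm_eq_abs, abs_le, dampingVariation]
  have h1 := neg_abs_le (derivWithin p (Ici 0) t)
  have h2 := le_abs_self (derivWithin p (Ici 0) t)
  have h3 := sq_nonneg (p t)
  constructor <;> linarith

/-- These are the y-terms of the amplitude equation beyond the constant coefficient κ; each carries
p, p' or p², which keeps the mass of the kernel O(A). -/
theorem isLittleO_integral_remainder (hp : IsSlowDamping p)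
    (hy : ContinuousOn y (Ici 0)) (hy0 : Tendsto y atTop (𝓝 0)) :
    (fun t => ∫ s in (0 : ℝ)..t, y s • (phase ω s * ((dampingWeight p s *
        (derivWithin p (Ici 0) s - ω ^ 2 * p s + p s ^ 2 / 2) : ℝ)
        + Complex.I * (dampingWeight p s * (-(ω * p s)) : ℝ)))) =o[atTop] dampingWeight p := by
  have cA := hp.continuousOn_dampingWeight
  have cp := hp.continuousOn
  have cP := hp.continuousOn_deriv
  have cph : ContinuousOn (phase ω) (Ici 0) := (continuous_phase ω).continuousOn
  have cc : ContinuousOn (fun s => phase ω s * ((dampingWeight p s *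
        (derivWithin p (Ici 0) s - ω ^ 2 * p s + p s ^ 2 / 2) : ℝ)
        + Complex.I * (dampingWeight p s * (-(ω * p s)) : ℝ))) (Ici 0) := by fun_prop
  refine isLittleO_integral_smul hp.tendsto_dampingWeight cc hy hy0
    (hp.isBigO_integral_norm (C := ω ^ 2 + |ω|) (by positivity) cc fun t ht => ?_)
  have hA := (dampingWeight_pos (p := p) t).le
  have hpt := (hp.pos t ht).le
  rw [norm_mul, norm_phase, one_mul]
  refine (norm_add_le _ _).trans ?_
  rw [norm_mul Complex.I, Complex.norm_I, one_mul, Complex.norm_real, Complex.norm_real,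
    norm_mul, norm_mul, Real.norm_of_nonneg hA, ← mul_add]
  refine mul_le_mul_of_nonneg_left ?_ hA
  rw [norm_neg, norm_mul, Real.norm_of_nonneg hpt, dampingVariation, Real.norm_eq_abs ω]
  have h4 : ‖derivWithin p (Ici 0) t - ω ^ 2 * p t + p t ^ 2 / 2‖
      ≤ |derivWithin p (Ici 0) t| + ω ^ 2 * p t + p t ^ 2 := by
    have h1 := neg_abs_le (derivWithin p (Ici 0) t)
    have h2 := le_abs_self (derivWithin p (Ici 0) t)
    have h3 := sq_nonneg (p t)
    have h5 : 0 ≤ ω ^ 2 * p t := by positivity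
    rw [Real.norm_eq_abs, abs_le]
    constructor <;> linarith
  linarith

/-- For the reduced system driven by `y → 0`, the state `(z, n)` decays if and only if the
Fourier-type integral of `A y` is `o(A)`; here `n` is only assumed to decay when `z` does. -/
theorem tendsto_zero_iff_isLittleO (hp : IsSlowDamping p) (hω : ω ≠ 0)
    (hz : ContinuousOn z (Ici 0)) (hn : ContinuousOn n (Ici 0)) (hy : ContinuousOn y (Ici 0))
    (hz0 : z 0 = 0) (hn0 : n 0 = 0)
    (hzd : ∀ t, 0 < t → HasDerivAt z
      (n t + (ω ^ 2 - p t) * z t + (2 * ω ^ 2 - p t) * y t) t)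
    (hnd : ∀ t, 0 < t → HasDerivAt n (-ω ^ 2 * n t +
      (derivWithin p (Ici 0) t + ω ^ 2 * p t - ω ^ 4 - ω ^ 2) * (z t + y t)) t)
    (hy0 : Tendsto y atTop (𝓝 0))
    (hnz : Tendsto z atTop (𝓝 0) → Tendsto n atTop (𝓝 0)) :
    Tendsto z atTop (𝓝 0) ↔
      (fun t => ∫ s in (0 : ℝ)..t, y s • (phase ω s * dampingWeight p s))
        =o[atTop] dampingWeight p := by
  have cA := hp.continuousOn_dampingWeight
  have cp := hp.continuousOn
  have cP := hp.continuousOn_deriv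
  have cph : ContinuousOn (phase ω) (Ici 0) := (continuous_phase ω).continuousOn
  set η : ℝ → ℂ := fun t => phase ω t *
    ((dampingWeight p t * (n t + ω ^ 2 * z t - p t / 2 * z t) : ℝ)
        + Complex.I * (ω * (dampingWeight p t * z t) : ℝ)) with hη
  have cη : ContinuousOn η (Ici 0) := by fun_prop
  set κ : ℂ := (ω ^ 4 - ω ^ 2 : ℝ) + Complex.I * (2 * ω ^ 3 : ℝ) with hκ
  -- The imaginary part 2ω³ never vanishes, whereas the real part does when |ω| = 1.
  have hκ0 : κ ≠ 0 := by
    intro h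
    have := congrArg Complex.im h
    simp [hκ, -Complex.ofReal_mul, -Complex.ofReal_pow, -Complex.ofReal_sub] at this
    exact hω this
  have key := fun t (ht : 0 ≤ t) =>
    hp.amplitude_eq (ω := ω) hz hn hy hz0 hn0 hzd hnd ht
  have hrem := hp.isLittleO_integral_remainder (ω := ω) hy hy0
  constructor
  · intro hzt
    have hvar := hp.isLittleO_integral_variation (ω := ω) hz hzt
    have hbz : Tendsto (fun t => p t / 2 * z t) atTop (𝓝 0) := by
      refine bdd_le_mul_tendsto_zero' (p 0) ?_ hzt
      filter_upwards [eventually_ge_atTop 0] with t ht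
      have h1 := hp.pos t ht
      rw [abs_of_pos (half_pos h1)]
      linarith [hp.le_zero ht]
    have hV : Tendsto (fun t => n t + ω ^ 2 * z t - p t / 2 * z t) atTop (𝓝 0) := by
      simpa using ((hnz hzt).add (hzt.const_mul (ω ^ 2))).sub hbz
    have hU : Tendsto (fun t => ω * z t) atTop (𝓝 0) := by simpa using hzt.const_mul ω
    have hηo : η =o[atTop] dampingWeight p := by
      have h1 : (fun t => |n t + ω ^ 2 * z t - p t / 2 * z t| + |ω * z t|) =o[atTop]
          (fun _ => (1 : ℝ)) := by
        rw [isLittleO_one_iff]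
        simpa using hV.abs.add hU.abs
      have h2 := (isBigO_refl (dampingWeight p) atTop).mul_isLittleO h1
      simp only [mul_one] at h2
      refine (IsBigO.of_norm_le fun t => ?_).trans_isLittleO h2
      have hA := (dampingWeight_pos (p := p) t).le
      rw [hη, norm_mul, norm_phase, one_mul]
      refine (norm_add_le _ _).trans_eq ?_
      rw [norm_mul Complex.I, Complex.norm_I, one_mul, Complex.norm_real, Complex.norm_real,
        mul_left_comm ω, norm_mul, norm_mul, Real.norm_of_nonneg hA, ← mul_add,
        Real.norm_eq_abs, Real.norm_eq_abs]
    have h3 := ((hηo.sub hvar).sub hrem).const_mul_left κ⁻¹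
    refine h3.congr' ?_ EventuallyEq.rfl
    filter_upwards [eventually_ge_atTop 0] with t ht
    simp only [hη]
    rw [key t ht, ← hκ, add_assoc, add_sub_cancel_left, add_sub_cancel_right,
      inv_mul_cancel_left₀ hκ0]
  · intro hI
    set h : ℝ → ℂ := fun t => κ * (∫ s in (0 : ℝ)..t, y s • (phase ω s * dampingWeight p s))
        + ∫ s in (0 : ℝ)..t, y s • (phase ω s * ((dampingWeight p s *
            (derivWithin p (Ici 0) s - ω ^ 2 * p s + p s ^ 2 / 2) : ℝ)
            + Complex.I * (dampingWeight p s * (-(ω * p s)) : ℝ))) with hh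
    have ho : h =o[atTop] dampingWeight p := (hI.const_mul_left κ).add hrem
    have c2 : ContinuousOn (fun s => y s • (phase ω s * dampingWeight p s)) (Ici 0) := by
      fun_prop
    have c3 : ContinuousOn (fun s => y s • (phase ω s * ((dampingWeight p s *
        (derivWithin p (Ici 0) s - ω ^ 2 * p s + p s ^ 2 / 2) : ℝ)
        + Complex.I * (dampingWeight p s * (-(ω * p s)) : ℝ)))) (Ici 0) := by fun_prop
    have ch : ContinuousOn h (Ici 0) :=
      (continuousOn_const.mul (continuousOn_primitive_Ici fun t ht =>
        c2.intervalIntegrable_of_Ici le_rfl ht)).add (continuousOn_primitive_Ici fun t ht =>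
        c3.intervalIntegrable_of_Ici le_rfl ht)
    have hωpos : 0 < |ω| := abs_pos.2 hω
    -- The phase has modulus one, and ωAz is the imaginary part of the unrotated amplitude.
    have hlow : ∀ t, |ω| * (dampingWeight p t * |z t|) ≤ ‖η t‖ := by
      intro t
      have hA := (dampingWeight_pos (p := p) t).le
      rw [hη, norm_mul, norm_phase, one_mul]
      refine le_of_eq_of_le ?_ (Complex.abs_im_le_norm _)
      simp only [Complex.add_im, Complex.ofReal_im, Complex.mul_im, Complex.I_re,
        Complex.I_im, Complex.ofReal_re, zero_mul, one_mul, zero_add]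
      rw [abs_mul, abs_mul, abs_of_nonneg hA]
    have hvar0 : ∀ t, 0 ≤ dampingVariation p t := fun t => by
      unfold dampingVariation; positivity
    obtain ⟨Q, hQ⟩ := hp.exists_integral_variation_le
    have ck : ContinuousOn (fun t => dampingVariation p t / |ω|) (Ici 0) :=
      hp.continuousOn_variation.div_const _
    -- In the first integral, A|z| is bounded by |η|/|ω|, which closes a Grönwall inequality with
    -- kernel (|p'| + p²)/|ω|.
    have hηo : η =o[atTop] dampingWeight p := by
      refine isLittleO_of_norm_le_add_integral (k := fun t => dampingVariation p t / |ω|)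
        (Q := Q / |ω|) hp.tendsto_dampingWeight hp.monotoneOn_dampingWeight
        (fun t _ => (dampingWeight_pos t).le) cη ch ck
        (fun t _ => div_nonneg (hvar0 t) hωpos.le) (fun t ht => ?_) ho fun t ht => ?_
      · rw [intervalIntegral.integral_div]
        exact div_le_div_of_nonneg_right (hQ t ht) hωpos.le
      · rw [hη]
        simp only
        rw [key t ht, add_assoc, add_comm, ← hκ]
        refine (norm_add_le _ _).trans (add_le_add le_rfl ?_)
        refine intervalIntegral.norm_integral_le_of_norm_le ht (ae_of_all _ fun s hs => ?_)
          ((ck.mul cη.norm).intervalIntegrable_of_Ici le_rfl ht)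
        have hA := (dampingWeight_pos (p := p) s).le
        have h5 := mul_le_mul_of_nonneg_left (hlow s) (div_nonneg (hvar0 s) hωpos.le)
        refine le_trans ?_ h5
        rw [norm_smul, norm_mul, norm_phase, one_mul, Complex.norm_real, norm_mul,
          Real.norm_of_nonneg hA, Real.norm_eq_abs, Real.norm_eq_abs]
        have h6 : |p s ^ 2 / 4 + derivWithin p (Ici 0) s / 2| ≤ dampingVariation p s := by
          rw [abs_le, dampingVariation]
          have h1 := neg_abs_le (derivWithin p (Ici 0) s)
          have h2 := le_abs_self (derivWithin p (Ici 0) s)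
          have h3 := sq_nonneg (p s)
          constructor <;> linarith
        have h7 : dampingVariation p s / |ω| * (|ω| * (dampingWeight p s * |z s|))
            = dampingWeight p s * |z s| * dampingVariation p s := by field_simp
        rw [h7]
        have h8 := mul_le_mul_of_nonneg_left h6 (mul_nonneg hA (abs_nonneg (z s)))
        linarith
    have h9 : (fun t => z t * dampingWeight p t) =o[atTop] dampingWeight p := by
      refine (IsBigO.of_bound |ω|⁻¹ (Eventually.of_forall fun t => ?_)).trans_isLittleO hηo
      have hA := (dampingWeight_pos (p := p) t).le
      rw [norm_mul, Real.norm_of_nonneg hA, Real.norm_eq_abs, ← div_eq_inv_mul,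
        le_div_iff₀ hωpos]
      linarith [hlow t]
    rw [isLittleO_iff_tendsto' (Eventually.of_forall fun t h =>
      absurd h (dampingWeight_pos t).ne')] at h9
    exact h9.congr fun t => mul_div_cancel_right₀ _ (dampingWeight_pos t).ne'

end IsSlowDamping

/-! ### Regularity of the filtered forcings. -/

section Filtered

variable {ω : ℝ} {f : ℝ → ℝ}

theorem MeasureTheory.LocallyIntegrableOn.intervalIntegrable_of_Ici
    (hf : LocallyIntegrableOn f (Ici 0) volume) {t : ℝ} (ht : 0 ≤ t) :
    IntervalIntegrable f volume 0 t :=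
  (intervalIntegrable_iff_integrableOn_Icc_of_le ht).2
    (hf.integrableOn_compact_subset Icc_subset_Ici_self isCompact_Icc)

theorem exp_mul_integral_exp (a : ℝ) (g : ℝ → ℝ) (t : ℝ) :
    Real.exp (a * t) * (∫ s in (0 : ℝ)..t, Real.exp (-a * (t - s)) * g s)
      = ∫ s in (0 : ℝ)..t, Real.exp (a * s) * g s := by
  rw [← intervalIntegral.integral_const_mul]
  refine intervalIntegral.integral_congr fun s _ => ?_
  rw [← mul_assoc, ← Real.exp_add]
  congr 2
  ring

theorem exp_mul_filteredForcing₁ (t : ℝ) :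
    Real.exp (ω ^ 2 * t) * filteredForcing₁ ω f t
      = ∫ s in (0 : ℝ)..t, Real.exp (ω ^ 2 * s) * f s :=
  exp_mul_integral_exp _ _ _

theorem exp_mul_filteredForcing₂ (t : ℝ) :
    Real.exp (ω ^ 2 * t) * filteredForcing₂ ω f t
      = ∫ s in (0 : ℝ)..t, Real.exp (ω ^ 2 * s) * filteredForcing₁ ω f s :=
  exp_mul_integral_exp _ _ _

theorem continuousOn_filteredForcing₁ (hf : LocallyIntegrableOn f (Ici 0) volume) :
    ContinuousOn (filteredForcing₁ ω f) (Ici 0) := by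
  have h : ContinuousOn (fun t => Real.exp (-(ω ^ 2 * t)) *
      ∫ s in (0 : ℝ)..t, Real.exp (ω ^ 2 * s) * f s) (Ici 0) :=
    (Continuous.continuousOn (by fun_prop)).mul (continuousOn_primitive_Ici fun t ht =>
      (hf.intervalIntegrable_of_Ici ht).continuousOn_mul (Continuous.continuousOn (by fun_prop)))
  refine h.congr fun t _ => ?_
  simp only
  rw [← exp_mul_filteredForcing₁, ← mul_assoc, ← Real.exp_add, neg_add_cancel, Real.exp_zero,
    one_mul]

theorem filteredForcing₂_eq (t : ℝ) :
    filteredForcing₂ ω f t = Real.exp (-(ω ^ 2 * t)) *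
      ∫ s in (0 : ℝ)..t, Real.exp (ω ^ 2 * s) * filteredForcing₁ ω f s := by
  rw [← exp_mul_filteredForcing₂, ← mul_assoc, ← Real.exp_add, neg_add_cancel, Real.exp_zero,
    one_mul]

theorem continuousOn_exp_mul_filteredForcing₁ (hf : LocallyIntegrableOn f (Ici 0) volume) :
    ContinuousOn (fun s => Real.exp (ω ^ 2 * s) * filteredForcing₁ ω f s) (Ici 0) :=
  (Continuous.continuousOn (by fun_prop)).mul (continuousOn_filteredForcing₁ hf)

theorem continuousOn_filteredForcing₂ (hf : LocallyIntegrableOn f (Ici 0) volume) :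
    ContinuousOn (filteredForcing₂ ω f) (Ici 0) := by
  refine ContinuousOn.congr ?_ fun t _ => filteredForcing₂_eq t
  exact (Continuous.continuousOn (by fun_prop)).mul (continuousOn_primitive_Ici fun t ht =>
    (continuousOn_exp_mul_filteredForcing₁ hf).intervalIntegrable_of_Ici le_rfl ht)

theorem hasDerivAt_filteredForcing₂ (hf : LocallyIntegrableOn f (Ici 0) volume) {t : ℝ}
    (ht : 0 < t) :
    HasDerivAt (filteredForcing₂ ω f)
      (filteredForcing₁ ω f t - ω ^ 2 * filteredForcing₂ ω f t) t := by
  have h1 : HasDerivAt (fun t : ℝ => Real.exp (-(ω ^ 2 * t)))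
      (Real.exp (-(ω ^ 2 * t)) * -(ω ^ 2 * 1)) t :=
    ((hasDerivAt_id t).const_mul (ω ^ 2)).neg.exp
  have h2 := h1.mul
    ((continuousOn_exp_mul_filteredForcing₁ (ω := ω) hf).hasDerivAt_primitive_Ici ht)
  have h3 : Real.exp (-(ω ^ 2 * t)) * Real.exp (ω ^ 2 * t) = 1 := by
    rw [← Real.exp_add, neg_add_cancel, Real.exp_zero]
  refine (h2.congr_deriv ?_).congr_of_eventuallyEq
    (Eventually.of_forall fun s => filteredForcing₂_eq s)
  rw [filteredForcing₂_eq t]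
  linear_combination filteredForcing₁ ω f t * h3

end Filtered

/-! ### The forced oscillator and its filtered velocity. -/

/-- The velocity of a solution with the singular part of the forcing filtered out. -/
noncomputable def filteredVelocity (ω : ℝ) (p f x : ℝ → ℝ) (t : ℝ) : ℝ :=
  derivWithin x (Ici 0) t + (p t - ω ^ 2) * x t - filteredForcing₁ ω f t

namespace IsForcedOscillatorSolution

variable {ω ξ₀ ξ₁ : ℝ} {p f x : ℝ → ℝ}

theorem hasDerivAt (hx : IsForcedOscillatorSolution ω p f ξ₀ ξ₁ x) {t : ℝ} (ht : 0 < t) :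
    HasDerivAt x (derivWithin x (Ici 0) t) t :=
  (hx.differentiableOn t ht.le).hasDerivWithinAt.hasDerivAt (Ici_mem_nhds ht)

theorem continuousOn_velocity (hx : IsForcedOscillatorSolution ω p f ξ₀ ξ₁ x) :
    ContinuousOn (derivWithin x (Ici 0)) (Ici 0) := by
  intro t ht
  have ht' : (0 : ℝ) ≤ t + 1 := add_nonneg ht zero_le_one
  have h := (hx.absolutelyContinuous (t + 1) ht').continuousOn
  rw [uIcc_of_le ht'] at h
  have hmem : Icc 0 (t + 1) ∈ 𝓝[Ici 0] t := by
    rw [← Ici_inter_Iic]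
    exact inter_mem self_mem_nhdsWithin
      (mem_nhdsWithin_of_mem_nhds (Iic_mem_nhds (lt_add_one t)))
  exact (h t ⟨ht, (lt_add_one t).le⟩).mono_of_mem_nhdsWithin hmem

/-- The equation holds only almost everywhere, so it is integrated against e^{ω²s} using absolute
continuity of x'. The contribution of f is exactly that of y₁ and cancels, leaving a continuous
integrand. -/
theorem exp_mul_filteredVelocity (hp : IsSlowDamping p)
    (hf : LocallyIntegrableOn f (Ici 0) volume)
    (hx : IsForcedOscillatorSolution ω p f 0 0 x) {t : ℝ} (ht : 0 ≤ t) :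
    Real.exp (ω ^ 2 * t) * filteredVelocity ω p f x t
      = ∫ s in (0 : ℝ)..t, x s * (Real.exp (ω ^ 2 * s) *
        (derivWithin p (Ici 0) s + ω ^ 2 * p s - ω ^ 4 - ω ^ 2)) := by
  set X := derivWithin x (Ici 0) with hX
  set P := derivWithin p (Ici 0) with hP
  have cx : ContinuousOn x (Ici 0) := hx.differentiableOn.continuousOn
  have cX : ContinuousOn X (Ici 0) := hx.continuousOn_velocity
  have cp := hp.continuousOn
  have cP : ContinuousOn P (Ici 0) := hp.continuousOn_deriv
  have hexp : ∀ s, HasDerivAt (fun u : ℝ => Real.exp (ω ^ 2 * u))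
      (Real.exp (ω ^ 2 * s) * (ω ^ 2 * 1)) s := fun s =>
    ((hasDerivAt_id s).const_mul (ω ^ 2)).exp
  have hac : AbsolutelyContinuousOnInterval (fun s => Real.exp (ω ^ 2 * s) * X s) 0 t := by
    refine AbsolutelyContinuousOnInterval.fun_mul ?_ (hx.absolutelyContinuous t ht)
    exact ContDiffOn.absolutelyContinuousOnInterval (ContDiff.contDiffOn (by fun_prop))
  have h1 := hac.integral_deriv_eq_sub
  have hcong : ∫ s in (0 : ℝ)..t, deriv (fun s => Real.exp (ω ^ 2 * s) * X s) s
      = ∫ s in (0 : ℝ)..t, (Real.exp (ω ^ 2 * s) * f s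
        + Real.exp (ω ^ 2 * s) * (ω ^ 2 * X s - p s * X s - ω ^ 2 * x s)) := by
    refine intervalIntegral.integral_congr_ae ?_
    filter_upwards [(ae_restrict_iff' measurableSet_Ioi).1 hx.equation] with s hs hst
    rw [uIoc_of_le ht] at hst
    rw [((hexp s).fun_mul (hs hst.1)).deriv]
    ring
  have cg : ContinuousOn
      (fun s => Real.exp (ω ^ 2 * s) * (ω ^ 2 * X s - p s * X s - ω ^ 2 * x s)) (Ici 0) := by
    fun_prop
  have hfi : IntervalIntegrable (fun s => Real.exp (ω ^ 2 * s) * f s) volume 0 t :=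
    (hf.intervalIntegrable_of_Ici ht).continuousOn_mul (Continuous.continuousOn (by fun_prop))
  have hX0 : X 0 = 0 := hx.initial_velocity
  rw [hcong, intervalIntegral.integral_add hfi (cg.intervalIntegrable_of_Ici le_rfl ht),
    ← exp_mul_filteredForcing₁, hX0] at h1
  have cg2 : ContinuousOn (fun s => Real.exp (ω ^ 2 * s) *
      (ω ^ 2 * (p s - ω ^ 2) * x s + P s * x s + (p s - ω ^ 2) * X s)) (Ici 0) := by fun_prop
  -- The term (p - ω²)x of n is differentiable at every s > 0, so the ordinary fundamental theorem
  -- suffices for it.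
  have h2 : ∫ s in (0 : ℝ)..t, Real.exp (ω ^ 2 * s) *
      (ω ^ 2 * (p s - ω ^ 2) * x s + P s * x s + (p s - ω ^ 2) * X s)
      = Real.exp (ω ^ 2 * t) * ((p t - ω ^ 2) * x t)
        - Real.exp (ω ^ 2 * 0) * ((p 0 - ω ^ 2) * x 0) := by
    refine integral_eq_sub_of_hasDerivAt_Ici
      (F := fun s => Real.exp (ω ^ 2 * s) * ((p s - ω ^ 2) * x s)) (by fun_prop) cg2
      (fun s hs => ?_) ht
    refine ((hexp s).fun_mul (((hp.hasDerivAt hs).sub_const _).fun_mul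
      (hx.hasDerivAt hs))).congr_deriv ?_
    ring
  rw [hx.initial_value] at h2
  have h3 : ∫ s in (0 : ℝ)..t, x s * (Real.exp (ω ^ 2 * s) *
        (P s + ω ^ 2 * p s - ω ^ 4 - ω ^ 2))
      = (∫ s in (0 : ℝ)..t, Real.exp (ω ^ 2 * s) * (ω ^ 2 * X s - p s * X s - ω ^ 2 * x s))
        + ∫ s in (0 : ℝ)..t, Real.exp (ω ^ 2 * s) *
          (ω ^ 2 * (p s - ω ^ 2) * x s + P s * x s + (p s - ω ^ 2) * X s) := by
    rw [← intervalIntegral.integral_add (cg.intervalIntegrable_of_Ici le_rfl ht)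
      (cg2.intervalIntegrable_of_Ici le_rfl ht)]
    refine intervalIntegral.integral_congr fun s _ => ?_
    ring
  rw [h3, h2, filteredVelocity, ← hX]
  linear_combination -h1

theorem continuousOn_filteredVelocity (hp : IsSlowDamping p)
    (hf : LocallyIntegrableOn f (Ici 0) volume)
    (hx : IsForcedOscillatorSolution ω p f 0 0 x) :
    ContinuousOn (filteredVelocity ω p f x) (Ici 0) :=
  (hx.continuousOn_velocity.add ((hp.continuousOn.sub continuousOn_const).mul
    hx.differentiableOn.continuousOn)).sub (continuousOn_filteredForcing₁ hf)

/-- Differentiating the integral formula gives a derivative at every t > 0, although x'' need only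
exist almost everywhere. -/
theorem hasDerivAt_filteredVelocity (hp : IsSlowDamping p)
    (hf : LocallyIntegrableOn f (Ici 0) volume)
    (hx : IsForcedOscillatorSolution ω p f 0 0 x) {t : ℝ} (ht : 0 < t) :
    HasDerivAt (filteredVelocity ω p f x) (-ω ^ 2 * filteredVelocity ω p f x t +
      (derivWithin p (Ici 0) t + ω ^ 2 * p t - ω ^ 4 - ω ^ 2) * x t) t := by
  have cx : ContinuousOn x (Ici 0) := hx.differentiableOn.continuousOn
  have cp := hp.continuousOn
  have cP := hp.continuousOn_deriv
  have cg : ContinuousOn (fun s => x s * (Real.exp (ω ^ 2 * s) *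
        (derivWithin p (Ici 0) s + ω ^ 2 * p s - ω ^ 4 - ω ^ 2))) (Ici 0) := by fun_prop
  have heq : ∀ s, 0 ≤ s → filteredVelocity ω p f x s = Real.exp (-(ω ^ 2 * s)) *
      ∫ s in (0 : ℝ)..s, x s * (Real.exp (ω ^ 2 * s) *
        (derivWithin p (Ici 0) s + ω ^ 2 * p s - ω ^ 4 - ω ^ 2)) := fun s hs => by
    rw [← exp_mul_filteredVelocity hp hf hx hs, ← mul_assoc, ← Real.exp_add, neg_add_cancel,
      Real.exp_zero, one_mul]
  have h1 : HasDerivAt (fun t : ℝ => Real.exp (-(ω ^ 2 * t)))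
      (Real.exp (-(ω ^ 2 * t)) * -(ω ^ 2 * 1)) t :=
    ((hasDerivAt_id t).const_mul (ω ^ 2)).neg.exp
  have h2 := h1.fun_mul (cg.hasDerivAt_primitive_Ici ht)
  have h3 : Real.exp (-(ω ^ 2 * t)) * Real.exp (ω ^ 2 * t) = 1 := by
    rw [← Real.exp_add, neg_add_cancel, Real.exp_zero]
  refine (h2.congr_deriv ?_).congr_of_eventuallyEq
    ((eventually_ge_nhds ht).mono fun s hs => heq s hs)
  rw [heq t ht.le]
  linear_combination x t *
    (derivWithin p (Ici 0) t + ω ^ 2 * p t - ω ^ 4 - ω ^ 2) * h3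

/-- In the coefficient of x, p' is integrable but not known to be bounded, so it goes into the
integrable part w; everything else is bounded. -/
theorem tendsto_filteredVelocity (hp : IsSlowDamping p) (hω : ω ≠ 0)
    (hf : LocallyIntegrableOn f (Ici 0) volume)
    (hx : IsForcedOscillatorSolution ω p f 0 0 x) (hx0 : Tendsto x atTop (𝓝 0)) :
    Tendsto (filteredVelocity ω p f x) atTop (𝓝 0) := by
  have cp := hp.continuousOn
  have cP := hp.continuousOn_deriv
  refine tendsto_zero_of_exp_mul_eq_integral
    (g := fun s => derivWithin p (Ici 0) s + ω ^ 2 * p s - ω ^ 4 - ω ^ 2)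
    (w := fun s => |derivWithin p (Ici 0) s|) (Q := p 0) (C := ω ^ 2 * p 0 + ω ^ 4 + ω ^ 2)
    (by positivity) (by fun_prop) hx.differentiableOn.continuousOn cP.abs (fun t ht => ?_)
    (fun _ _ => abs_nonneg _) (fun t ht => hp.integral_abs_deriv_le ht)
    (fun t ht => exp_mul_filteredVelocity hp hf hx ht) hx0
  have h1 := neg_abs_le (derivWithin p (Ici 0) t)
  have h2 := le_abs_self (derivWithin p (Ici 0) t)
  have h3 := mul_le_mul_of_nonneg_left (hp.le_zero ht) (sq_nonneg ω)
  have h4 := mul_nonneg (sq_nonneg ω) (hp.pos t ht).le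
  have h5 : 0 ≤ ω ^ 4 := by positivity
  have h6 : 0 ≤ ω ^ 2 := by positivity
  rw [Real.norm_eq_abs, abs_le]
  constructor <;> linarith

theorem hasDerivAt_sub_filteredForcing₂ (hf : LocallyIntegrableOn f (Ici 0) volume)
    (hx : IsForcedOscillatorSolution ω p f 0 0 x) {t : ℝ} (ht : 0 < t) :
    HasDerivAt (fun s => x s - filteredForcing₂ ω f s)
      (filteredVelocity ω p f x t + (ω ^ 2 - p t) * (x t - filteredForcing₂ ω f t) +
        (2 * ω ^ 2 - p t) * filteredForcing₂ ω f t) t := by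
  refine ((hx.hasDerivAt ht).fun_sub (hasDerivAt_filteredForcing₂ hf ht)).congr_deriv ?_
  rw [filteredVelocity]
  ring

/-- A decaying solution forces the twice filtered forcing to decay. -/
theorem tendsto_filteredForcing₂ (hp : IsSlowDamping p) (hω : ω ≠ 0)
    (hf : LocallyIntegrableOn f (Ici 0) volume)
    (hx : IsForcedOscillatorSolution ω p f 0 0 x) (hx0 : Tendsto x atTop (𝓝 0)) :
    Tendsto (filteredForcing₂ ω f) atTop (𝓝 0) := by
  have cx : ContinuousOn x (Ici 0) := hx.differentiableOn.continuousOn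
  have cp := hp.continuousOn
  have cy := continuousOn_filteredForcing₂ (ω := ω) hf
  have cn := continuousOn_filteredVelocity hp hf hx
  have hn := tendsto_filteredVelocity hp hω hf hx hx0
  have hpx : Tendsto (fun t => p t * x t) atTop (𝓝 0) := by
    refine bdd_le_mul_tendsto_zero' (p 0) ?_ hx0
    filter_upwards [eventually_ge_atTop 0] with t ht
    rw [abs_of_pos (hp.pos t ht)]
    exact hp.le_zero ht
  have hdrive : Tendsto (fun t => filteredVelocity ω p f x t - p t * x t + 2 * ω ^ 2 * x t)
      atTop (𝓝 0) := by simpa using (hn.sub hpx).add (hx0.const_mul (2 * ω ^ 2))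
  -- In terms of x, the equation for z becomes z' = -ω²z + (n - px + 2ω²x), a stable equation whose
  -- drive tends to zero.
  have hz : Tendsto (fun t => x t - filteredForcing₂ ω f t) atTop (𝓝 0) := by
    refine tendsto_zero_of_exp_mul_eq_integral (a := ω ^ 2) (g := fun _ => 1) (w := fun _ => 0)
      (C := 1) (Q := 0) (by positivity) continuousOn_const
      (y := fun t => filteredVelocity ω p f x t - p t * x t + 2 * ω ^ 2 * x t) (by fun_prop)
      continuousOn_const (by simp) (by simp) (by simp) (fun t ht => ?_) hdrive
    rw [integral_eq_sub_of_hasDerivAt_Ici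
      (F := fun t => Real.exp (ω ^ 2 * t) * (x t - filteredForcing₂ ω f t)) (by fun_prop)
      (by fun_prop) (fun s hs => ?_) ht]
    · simp [hx.initial_value, filteredForcing₂]
    · refine ((((hasDerivAt_id s).const_mul (ω ^ 2)).exp).fun_mul
        (hasDerivAt_sub_filteredForcing₂ hf hx hs)).congr_deriv ?_
      simp only [id]
      ring
  simpa using hx0.sub hz

end IsForcedOscillatorSolution

/-! ### The characterisation of decay. -/

theorem mainTheorem1 (ω : ℝ) (hω : ω ≠ 0) (p f x : ℝ → ℝ)
    (hp_C1 : ContDiffOn ℝ 1 p (Ici 0))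
    (hp_pos : ∀ t : ℝ, 0 ≤ t → 0 < p t)
    (hp_deriv : ∀ t : ℝ, 0 ≤ t → derivWithin p (Ici 0) t < 0)
    (hp_not_integrable : ¬ IntegrableOn p (Ioi 0) volume)
    (hp_sq_integrable : IntegrableOn (fun t => p t ^ 2) (Ioi 0) volume)
    (hf : LocallyIntegrableOn f (Ici 0) volume)
    (hx : IsForcedOscillatorSolution ω p f 0 0 x) :
    Tendsto x atTop (𝓝 0) ↔
      (Tendsto (filteredForcing₂ ω f) atTop (𝓝 0) ∧
        (fun t : ℝ => ∫ s in (0 : ℝ)..t,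
            Real.cos (ω * s) * dampingWeight p s * filteredForcing₂ ω f s)
          =o[atTop] dampingWeight p ∧
        (fun t : ℝ => ∫ s in (0 : ℝ)..t,
            Real.sin (ω * s) * dampingWeight p s * filteredForcing₂ ω f s)
          =o[atTop] dampingWeight p) := by
  have hp : IsSlowDamping p :=
    ⟨hp_C1, hp_pos, hp_deriv, hp_not_integrable, hp_sq_integrable⟩
  have cx : ContinuousOn x (Ici 0) := hx.differentiableOn.continuousOn
  have cy := continuousOn_filteredForcing₂ (ω := ω) hf
  -- The reduced criterion presupposes y₂ → 0: one direction derives this from x → 0, the other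
  -- assumes it.
  have main := fun hy0 : Tendsto (filteredForcing₂ ω f) atTop (𝓝 0) =>
    hp.tendsto_zero_iff_isLittleO hω (z := fun t => x t - filteredForcing₂ ω f t)
      (n := filteredVelocity ω p f x) (y := filteredForcing₂ ω f) (cx.sub cy)
      (hx.continuousOn_filteredVelocity hp hf) cy
      (by simp [hx.initial_value, filteredForcing₂])
      (by simp [filteredVelocity, hx.initial_value, hx.initial_velocity, filteredForcing₁])
      (fun t ht => hx.hasDerivAt_sub_filteredForcing₂ hf ht)
      (fun t ht => by
        simpa only [sub_add_cancel] using hx.hasDerivAt_filteredVelocity hp hf ht)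
      hy0
      (fun hz => hx.tendsto_filteredVelocity hp hω hf (by simpa using hz.add hy0))
  rw [← isLittleO_integral_phase_iff hp.continuousOn_dampingWeight cy]
  constructor
  · intro hx0
    have hy0 := hx.tendsto_filteredForcing₂ hp hω hf hx0
    exact ⟨hy0, (main hy0).1 (by simpa using hx0.sub hy0)⟩
  · rintro ⟨hy0, hI⟩
    simpa using ((main hy0).2 hI).add hy0
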